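/- Let $\mathcal F$ be the class of continuous distribution functions $F$ on $\mathbb R$ with $F(0)=0$ that have a density $f$ which is the sum of its Maclaurin series at every $x>0$, i.e. $f(x)=\sum_{q\ge 0} f^{(q)}(0)\,x^q/q!$ for all $x>0$ (with right-hand derivatives at $0$). Let $n\ge 2$ and let $X_1,\dots,X_n$ be independent random variables with common distribution function $F\in\mathcal F$. Fix an integer $k$ with $1\le k\le n$, and let $X_{(k;n)}$ denote the $k$-th order statistic, i.e. the $k$-th smallest among $X_1,\dots,X_n$. If $$\frac{1}{n}X_1+\frac{1}{n-1}X_2+\cdots+\frac{1}{n-k+1}X_k\ \overset{d}{=}\ X_{(k;n)},$$ then $F$ is the distribution function of an exponential distribution with some rate $\lambda>0$, i.e. $F(x)=1-e^{-\lambda x}$ for all $x\ge 0$. -/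

import Mathlib

open MeasureTheory ProbabilityTheory

/-- The law `μ` on `ℝ` has a distribution function `F` that is continuous, satisfies `F 0 = 0`, and
has a density `f` that is the sum of its Maclaurin series at every `x > 0`.
(The coefficient `a q` is then necessarily the `q`-th right derivative of `f` at `0`, divided
by `q!`; the derivatives at `0` are one-sided, since `f` vanishes on the negative half-line.) -/
structure HasMaclaurinDensity (μ : Measure ℝ) : Prop where
  continuous_cdf : Continuous (cdf μ)
  cdf_zero : cdf μ 0 = 0
  density : ∃ f : ℝ → ℝ, Measurable f ∧ (∀ x, 0 ≤ f x) ∧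
    μ = volume.withDensity (fun x => ENNReal.ofReal (f x)) ∧
    ∃ a : ℕ → ℝ, ∀ x : ℝ, 0 < x → HasSum (fun q : ℕ => a q * x ^ q) (f x)

/-- The order statistics of a finite sample: `orderStatistic x i` is the entry at the zero-based
position `i` of the increasing rearrangement of `x`, so `i = 0` gives the minimum and the `k`-th
smallest value has `i = k - 1`. -/
noncomputable def orderStatistic {n : ℕ} (x : Fin n → ℝ) (i : Fin n) : ℝ :=
  x (Tuple.sort x i)

/-!
A density that is the sum of its Maclaurin series is encoded by the formal series `Φ` of its
derivatives at `0`. In these terms the distribution function of a sum of independent variables is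
the Borel transform of a product of series, and that of the order statistic is a polynomial in
the common distribution function, so the hypothesis becomes an identity between formal power
series in `Φ`.

Suppose first that `Φ` starts with a multiple of `X ^ r`. Comparing the lowest coefficients on the
two sides gives an equation between products of factorials, which for `r ≥ 1` is excluded by size
when `k = 1`, by parity when `r = 1`, and by a Bertrand prime otherwise. Hence `f 0 ≠ 0`. Next, if
two solutions agree below degree `m`, their coefficients of degree `m` differ by some `δ` with
`(∑ i < k, (n - i) ^ m) * δ = (m + k).choose (m + 1) * δ`, and the sum is larger than the binomial
coefficient unless `k = n` and `m = 1`. So `f 0` determines `Φ` when `k < n`, and `f 0` together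
with `f' 0` does when `k = n`. Exponential functions realise all these initial data: every
`a * exp (-a * x)` is a solution by Rényi's representation of order statistics, and for `k = n`,
where `X_1 + X_2 / 2 + ⋯ + X_i / i` has distribution function `F ^ i`, so is `a * exp (ρ * x)`. That
`f` is a probability density then forces `a = -ρ > 0`.
-/

open scoped Nat

section Arithmetic

theorem choose_succ_lt_sum_range_sub_pow {n k m : ℕ} (hk : 1 ≤ k) (hm : 1 ≤ m)
    (h : k < n ∨ k = n ∧ 2 ≤ n ∧ 2 ≤ m) :
    (m + k).choose (m + 1) < ∑ i ∈ Finset.range k, (n - i) ^ m := by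
  have hockey : (m + k).choose (m + 1) = ∑ i ∈ Finset.range k, (i + m).choose m := by
    obtain ⟨k, rfl⟩ := Nat.exists_eq_add_of_le' hk
    rw [Nat.sum_range_add_choose]
    ring_nf
  rw [hockey, ← Finset.sum_range_reflect (fun i => (n - i) ^ m)]
  rcases h with hkn | ⟨rfl, hk2, hm2⟩
  · refine Finset.sum_lt_sum_of_nonempty (Finset.nonempty_range_iff.2 (by omega)) fun i hi => ?_
    have := Finset.mem_range.1 hi
    exact (Nat.choose_add_le_add_one_pow i m).trans_lt (Nat.pow_lt_pow_left (by omega) (by omega))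
  · refine Finset.sum_lt_sum (fun i hi => ?_) ⟨1, Finset.mem_range.2 (by omega), ?_⟩
    · have := Finset.mem_range.1 hi
      exact (Nat.choose_add_le_add_one_pow i m).trans (Nat.pow_le_pow_left (by omega) m)
    · rw [add_comm, Nat.choose_succ_self_right, show k - (k - 1 - 1) = 2 by omega]
      obtain ⟨m, rfl⟩ := Nat.exists_eq_add_of_le' hm2
      have := Nat.lt_two_pow_self (n := m)
      rw [pow_add]
      omega

theorem exists_prime_factorization_factorial_eq_one {N : ℕ} (hN : 3 ≤ N) :
    ∃ p, p.Prime ∧ N < 2 * p ∧ (N !).factorization p = 1 := by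
  obtain ⟨p, hp, hlt, hle⟩ := Nat.exists_prime_lt_and_le_two_mul (N / 2) (by omega)
  have hN2 : N < 2 * p := by omega
  refine ⟨p, hp, hN2, ?_⟩
  have hlog : Nat.log p N < 2 :=
    Nat.log_lt_of_lt_pow (by omega) (by nlinarith [hp.two_le])
  rw [Nat.factorization_factorial hp hlog]
  simpa using Nat.div_eq_of_lt_le (by omega) (by omega)

theorem factorization_factorial_eq_zero_of_lt {p N : ℕ} (hp : p.Prime) (h : N < p) :
    (N !).factorization p = 0 :=
  Nat.factorization_eq_zero_of_not_dvd (mt hp.dvd_factorial.1 h.not_ge)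

-- A prime between half of `k * (m + 1)` and `k * (m + 1)` divides the right side exactly once, but
-- enters the left side only through an `m`-th power.
theorem pow_mul_factorial_pow_mul_factorial_ne_factorial {k m : ℕ} (hk : 2 ≤ k) (hm : 2 ≤ m)
    (a : ℕ) : a ^ m * (m + 1)! ^ k * k ! ≠ (k * (m + 1))! := by
  intro h
  have hkN : 2 * k ≤ k * (m + 1) := by nlinarith
  have hmN : 2 * (m + 1) ≤ k * (m + 1) := Nat.mul_le_mul_right _ hk
  obtain ⟨p, hp, hlt, hone⟩ := exists_prime_factorization_factorial_eq_one (N := k * (m + 1))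
    (by omega)
  have ha : a ^ m ≠ 0 := by
    rintro ha
    simp [ha, (Nat.factorial_ne_zero _).symm] at h
  rw [← h, Nat.factorization_mul (by positivity) (by positivity),
    Nat.factorization_mul ha (by positivity), Nat.factorization_pow, Nat.factorization_pow] at hone
  simp only [Finsupp.add_apply, Finsupp.smul_apply, smul_eq_mul, mul_zero, add_zero,
    factorization_factorial_eq_zero_of_lt hp (show k < p by omega),
    factorization_factorial_eq_zero_of_lt hp (show m + 1 < p by omega)] at hone
  have := Nat.eq_one_of_mul_eq_one_right hone
  omega

theorem odd_doubleFactorial_two_mul_add_one (n : ℕ) : Odd (2 * n + 1)‼ := by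
  induction n with
  | zero => simp
  | succ n ih => exact (odd_two_mul_add_one (n + 1)).mul ih

-- Equality would force `n.descFactorial k = (2 * k - 1)‼`, which is odd, while `k !` divides
-- `n.descFactorial k`.
theorem descFactorial_mul_two_pow_mul_factorial_ne_factorial {k : ℕ} (hk : 2 ≤ k) (n : ℕ) :
    n.descFactorial k * (2 ^ k * k !) ≠ (2 * k)! := by
  obtain ⟨j, rfl⟩ := Nat.exists_eq_add_of_le' (one_le_two.trans hk)
  intro h
  have heq : n.descFactorial (j + 1) = (2 * j + 1)‼ := by
    refine Nat.eq_of_mul_eq_mul_right (by positivity : 0 < 2 ^ (j + 1) * (j + 1)!) ?_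
    rw [h, ← Nat.doubleFactorial_two_mul, mul_comm (_‼)]
    exact Nat.factorial_eq_mul_doubleFactorial (2 * j + 1)
  have heven : 2 ∣ n.descFactorial (j + 1) :=
    (Nat.dvd_factorial two_pos hk).trans (Nat.factorial_dvd_descFactorial n (j + 1))
  rw [heq] at heven
  exact (odd_doubleFactorial_two_mul_add_one j).not_two_dvd_nat heven

theorem descFactorial_pow_mul_ne_factorial {n k m : ℕ} (hn : 2 ≤ n) (hk : 1 ≤ k) (hm : 1 ≤ m) :
    n.descFactorial k ^ m * (m + 1)! ^ k * k ! ≠ (k * (m + 1))! := by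
  rcases hk.eq_or_lt with rfl | hk2
  · have : 1 < n ^ m := Nat.one_lt_pow (by omega) hn
    have := (m + 1).factorial_pos
    simp only [Nat.descFactorial_one, pow_one, Nat.factorial_one, mul_one, one_mul]
    nlinarith
  rcases hm.eq_or_lt with rfl | hm2
  · simpa [mul_assoc, mul_comm k] using descFactorial_mul_two_pow_mul_factorial_ne_factorial hk2 n
  · exact pow_mul_factorial_pow_mul_factorial_ne_factorial hk2 hm2 _

end Arithmetic

section BinomialTail

variable (R : Type*) [CommRing R]

/-- The polynomial whose value at `p` is the probability that a binomial random variable with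
parameters `n` and `p` is at least `k`; it expresses the distribution function of the `k`-th order
statistic of a sample of size `n` through the distribution function of the sample. -/
noncomputable def binomialTail (n k : ℕ) : Polynomial R :=
  ∑ j ∈ Finset.Ico k (n + 1), bernsteinPolynomial R n j

theorem binomialTail_zero (n : ℕ) : binomialTail R n 0 = 1 := by
  rw [binomialTail, ← Finset.range_eq_Ico, bernsteinPolynomial.sum]

theorem binomialTail_self (n : ℕ) : binomialTail R n n = Polynomial.X ^ n := by
  simp [binomialTail, bernsteinPolynomial]

theorem binomialTail_eq_add (n k : ℕ) :
    binomialTail R n k = bernsteinPolynomial R n k + binomialTail R n (k + 1) := by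
  rcases Nat.lt_or_ge n k with h | h
  · simp [binomialTail, bernsteinPolynomial.eq_zero_of_lt R h,
      Finset.Ico_eq_empty_of_le (Nat.succ_le_of_lt h),
      Finset.Ico_eq_empty_of_le ((Nat.succ_le_of_lt h).trans k.le_succ)]
  · exact Finset.sum_eq_sum_Ico_succ_bot (by omega) _

theorem X_pow_dvd_binomialTail (n k : ℕ) : Polynomial.X ^ k ∣ binomialTail R n k := by
  refine Finset.dvd_sum fun j hj => ?_
  rw [bernsteinPolynomial, mul_assoc]
  exact ((pow_dvd_pow _ (Finset.mem_Ico.1 hj).1).mul_right _).mul_left _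

theorem exists_binomialTail_eq_X_pow_mul (n k : ℕ) :
    ∃ W : Polynomial R, binomialTail R n k = Polynomial.X ^ k * W ∧ W.eval 0 = n.choose k := by
  obtain ⟨V, hV⟩ := X_pow_dvd_binomialTail R n (k + 1)
  refine ⟨(n.choose k : Polynomial R) * (1 - Polynomial.X) ^ (n - k) + Polynomial.X * V, ?_, ?_⟩
  · rw [binomialTail_eq_add, hV, bernsteinPolynomial]
    ring
  · simp

theorem derivative_binomialTail_succ (n k : ℕ) :
    Polynomial.derivative (binomialTail R n (k + 1)) = n * bernsteinPolynomial R (n - 1) k := by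
  induction k with
  | zero =>
    have h := congrArg Polynomial.derivative (binomialTail_eq_add R n 0)
    rw [binomialTail_zero, Polynomial.derivative_add, bernsteinPolynomial.derivative_zero,
      Polynomial.derivative_one] at h
    linear_combination -h
  | succ k ih =>
    have h := congrArg Polynomial.derivative (binomialTail_eq_add R n (k + 1))
    rw [ih, Polynomial.derivative_add, bernsteinPolynomial.derivative_succ] at h
    linear_combination -h

theorem one_sub_X_mul_bernsteinPolynomial (n k : ℕ) :
    (1 - Polynomial.X) * ((n + 1 : Polynomial R) * bernsteinPolynomial R n k) =
      (n + 1 - k : Polynomial R) * bernsteinPolynomial R (n + 1) k := by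
  rcases Nat.lt_or_ge n k with h | h
  · rw [bernsteinPolynomial.eq_zero_of_lt R h]
    rcases (Nat.succ_le_of_lt h).eq_or_lt with rfl | h'
    · simp
    · simp [bernsteinPolynomial.eq_zero_of_lt R h']
  · have hchoose := congrArg (Nat.cast (R := Polynomial R)) (Nat.choose_mul_succ_eq n k)
    push_cast [Nat.cast_sub (h.trans n.le_succ)] at hchoose
    rw [bernsteinPolynomial, bernsteinPolynomial, Nat.succ_sub h, pow_succ]
    linear_combination
      Polynomial.X ^ k * (1 - Polynomial.X) ^ (n - k) * (1 - Polynomial.X) * hchoose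

theorem one_sub_X_mul_derivative_binomialTail (n k : ℕ) :
    (1 - Polynomial.X) * Polynomial.derivative (binomialTail R n (k + 1)) =
      (n - k : Polynomial R) * bernsteinPolynomial R n k := by
  rw [derivative_binomialTail_succ]
  rcases n with - | n
  · rcases k with - | k
    · simp
    · simp [bernsteinPolynomial.eq_zero_of_lt R k.succ_pos]
  · simpa using one_sub_X_mul_bernsteinPolynomial R n k

end BinomialTail

section FormalSeries

open PowerSeries

section Ring

variable {R : Type*} [CommRing R]

theorem dvd_prod_sub_prod {ι : Type*} (s : Finset ι) {d : R} {a b : ι → R}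
    (h : ∀ i ∈ s, d ∣ a i - b i) :
    d ∣ ∏ i ∈ s, a i - ∏ i ∈ s, b i := by
  simp only [← Ideal.mem_span_singleton, ← Ideal.Quotient.mk_eq_mk_iff_sub_mem] at h ⊢
  simpa only [map_prod] using Finset.prod_congr rfl h

theorem sub_dvd_aeval_sub {S : Type*} [CommRing S] [Algebra R S] (P : Polynomial R) (a b : S) :
    a - b ∣ Polynomial.aeval a P - Polynomial.aeval b P := by
  simpa only [Polynomial.eval_map_algebraMap] using
    Polynomial.sub_dvd_eval_sub a b (P.map (algebraMap R S))

theorem exists_constantCoeff_ne_zero_and_eq_X_pow_mul {A : R⟦X⟧} (hA : A ≠ 0) :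
    ∃ (r : ℕ) (U : R⟦X⟧), constantCoeff U ≠ 0 ∧ A = X ^ r * U :=
  ⟨A.order.toNat, A.divXPowOrder, constantCoeff_divXPowOrder_eq_zero_iff.not.2 hA,
    X_pow_order_mul_divXPowOrder.symm⟩

theorem coeff_X_pow_mul_self (m : ℕ) (A : R⟦X⟧) : coeff m (X ^ m * A) = constantCoeff A := by
  simpa using coeff_X_pow_mul A m 0

theorem constantCoeff_rescale (c : R) (A : R⟦X⟧) :
    constantCoeff (rescale c A) = constantCoeff A := by
  rw [← coeff_zero_eq_constantCoeff_apply, coeff_rescale, pow_zero, one_mul,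
    coeff_zero_eq_constantCoeff_apply]

theorem constantCoeff_aeval (P : Polynomial R) (A : R⟦X⟧) :
    constantCoeff (Polynomial.aeval A P) = P.eval (constantCoeff A) := by
  rw [Polynomial.aeval_def, Polynomial.hom_eval₂]
  rfl

theorem constantCoeff_eq_of_X_pow_dvd_sub {m : ℕ} (hm : m ≠ 0) {A B : R⟦X⟧} (h : X ^ m ∣ A - B) :
    constantCoeff A = constantCoeff B := by
  have := X_pow_dvd_iff.1 h 0 (Nat.pos_of_ne_zero hm)
  rwa [coeff_zero_eq_constantCoeff_apply, map_sub, sub_eq_zero] at this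

theorem coeff_mul_sub_mul {m : ℕ} (hm : m ≠ 0) {A B A' B' : R⟦X⟧} (hA : X ^ m ∣ A - A')
    (hB : X ^ m ∣ B - B') :
    coeff m (A * B - A' * B') =
      coeff m (A - A') * constantCoeff B + constantCoeff A * coeff m (B - B') := by
  rw [constantCoeff_eq_of_X_pow_dvd_sub hm hA]
  obtain ⟨D, hD⟩ := hA
  obtain ⟨E, hE⟩ := hB
  have : A * B - A' * B' = X ^ m * (D * B + A' * E) := by
    linear_combination B * hD + A' * hE
  simp only [this, hD, hE, coeff_X_pow_mul_self, map_add, map_mul]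

theorem coeff_prod_sub_prod {ι : Type*} (s : Finset ι) {m : ℕ} (hm : m ≠ 0) {b : R}
    {A B : ι → R⟦X⟧} (hAB : ∀ i ∈ s, X ^ m ∣ A i - B i) (hA : ∀ i ∈ s, constantCoeff (A i) = b) :
    coeff m (∏ i ∈ s, A i - ∏ i ∈ s, B i) =
      (∑ i ∈ s, coeff m (A i - B i)) * b ^ (s.card - 1) := by
  classical
  induction s using Finset.induction_on with
  | empty => simp
  | insert j s hj ih =>
    rw [Finset.forall_mem_insert] at hAB hA
    rw [Finset.prod_insert hj, Finset.prod_insert hj, Finset.sum_insert hj,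
      Finset.card_insert_of_notMem hj, Nat.add_sub_cancel,
      coeff_mul_sub_mul hm hAB.1 (dvd_prod_sub_prod s hAB.2), ih hAB.2 hA.2, map_prod, hA.1,
      Finset.prod_congr rfl hA.2, Finset.prod_const]
    rcases s.eq_empty_or_nonempty with rfl | hs
    · simp
    · rw [← mul_pow_sub_one hs.card_ne_zero b]
      ring

theorem coeff_aeval_X_pow_mul_sub {m k : ℕ} (hm : m ≠ 0) {A B : R⟦X⟧} (hAB : X ^ m ∣ A - B)
    (W : Polynomial R) :
    coeff (m + k) (Polynomial.aeval (X * A) (Polynomial.X ^ k * W) -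
        Polynomial.aeval (X * B) (Polynomial.X ^ k * W)) =
      W.eval 0 * k * coeff m (A - B) * constantCoeff A ^ (k - 1) := by
  have hW : X ^ (m + 1) ∣ Polynomial.aeval (X * A) W - Polynomial.aeval (X * B) W := by
    refine dvd_trans ?_ (sub_dvd_aeval_sub W _ _)
    rw [← mul_sub, pow_succ']
    exact mul_dvd_mul_left X hAB
  have hW0 : coeff m (Polynomial.aeval (X * A) W - Polynomial.aeval (X * B) W) = 0 :=
    X_pow_dvd_iff.1 hW m m.lt_succ_self
  have hpow : X ^ m ∣ A ^ k - B ^ k := hAB.trans (sub_dvd_pow_sub_pow A B k)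
  have hpowm : coeff m (A ^ k - B ^ k) = k * coeff m (A - B) * constantCoeff A ^ (k - 1) := by
    have := coeff_prod_sub_prod (Finset.range k) hm (A := fun _ => A) (B := fun _ => B)
      (fun _ _ => hAB) (fun _ _ => rfl)
    simpa only [Finset.prod_const, Finset.sum_const, Finset.card_range, nsmul_eq_mul] using this
  simp only [map_mul, map_pow, Polynomial.aeval_X, mul_pow, mul_assoc (X ^ k)]
  rw [← mul_sub, coeff_X_pow_mul,
    coeff_mul_sub_mul hm hpow ((pow_dvd_pow X m.le_succ).trans hW), hW0, hpowm,
    constantCoeff_aeval]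
  simp only [map_mul, constantCoeff_X, zero_mul, mul_zero, add_zero]
  ring

end Ring

section BorelTransform

variable {K : Type*} [Field K]

/-- The formal Borel transform `∑ A_q x ^ q ↦ ∑ A_q x ^ q / q!`. If `A_q` is the `q`-th derivative
at `0` of a function, then its image is the Maclaurin series of the function. The transform turns
the product of series into the convolution of functions, with `X * A` standing for the function
with derivative sequence `A` integrated from `0`. -/
noncomputable def borelTransform : K⟦X⟧ →ₗ[K] K⟦X⟧ where
  toFun A := PowerSeries.mk fun q => coeff q A / (q ! : K)
  map_add' A B := by ext q; simp [add_div]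
  map_smul' r A := by ext q; simp [mul_div_assoc]

theorem coeff_borelTransform (q : ℕ) (A : K⟦X⟧) :
    coeff q (borelTransform A) = coeff q A / (q ! : K) := by
  simp [borelTransform]

theorem borelTransform_C_mul (r : K) (A : K⟦X⟧) :
    borelTransform (C r * A) = C r * borelTransform A := by
  rw [← smul_eq_C_mul, ← smul_eq_C_mul, map_smul]

theorem borelTransform_C (r : K) : borelTransform (C r) = C r := by
  ext q
  rcases q with - | q <;> simp [coeff_borelTransform, coeff_C]

theorem borelTransform_one : borelTransform (1 : K⟦X⟧) = 1 := by
  simpa using borelTransform_C (1 : K)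

theorem exists_borelTransform_X_pow_mul_eq (m : ℕ) (A : K⟦X⟧) :
    ∃ V : K⟦X⟧, borelTransform (X ^ m * A) = X ^ m * V ∧ ∀ q, coeff q V = coeff q A / (q + m)! := by
  refine ⟨PowerSeries.mk fun q => coeff q A / (q + m)!, ?_, fun q => coeff_mk _ _⟩
  ext q
  rw [coeff_borelTransform, coeff_X_pow_mul', coeff_X_pow_mul']
  split_ifs with h
  · rw [coeff_mk, Nat.sub_add_cancel h]
  · exact zero_div _

theorem constantCoeff_borelTransform_X_mul (A : K⟦X⟧) :
    constantCoeff (borelTransform (X * A)) = 0 := by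
  rw [← coeff_zero_eq_constantCoeff_apply, coeff_borelTransform, coeff_zero_X_mul, zero_div]

theorem derivative_borelTransform_X_mul [CharZero K] (A : K⟦X⟧) :
    d⁄dX K (borelTransform (X * A)) = borelTransform A := by
  ext q
  have : (q + 1 : K) ≠ 0 := by exact_mod_cast q.succ_ne_zero
  rw [coeff_derivative, coeff_borelTransform, coeff_borelTransform, coeff_succ_X_mul,
    Nat.factorial_succ]
  push_cast
  field_simp

theorem eq_of_derivative_eq_C_mul_add [CharZero K] {r : K} {A B G : K⟦X⟧}
    (hA : d⁄dX K A = C r * A + G) (hB : d⁄dX K B = C r * B + G)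
    (h0 : constantCoeff A = constantCoeff B) : A = B := by
  ext q
  induction q with
  | zero => simpa using h0
  | succ q ih =>
    have hA' := congrArg (coeff q) hA
    have hB' := congrArg (coeff q) hB
    rw [coeff_derivative, map_add, coeff_C_mul] at hA' hB'
    have hq : (q + 1 : K) ≠ 0 := by exact_mod_cast q.succ_ne_zero
    exact mul_right_cancel₀ hq (by rw [hA', hB', ih])

end BorelTransform

section GeometricSeries

variable {K : Type*} [Field K]

/-- The series of derivatives at `0` of `x ↦ c * f (c * x)`, the density of `T / c` when `T` has
density `f`; here `Φ` is the series of derivatives of `f` at `0`. -/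
noncomputable def scaleDensity (c : K) (Φ : K⟦X⟧) : K⟦X⟧ :=
  C c * rescale c Φ

/-- The geometric series with first term `a` and ratio `ρ`, which is the series of derivatives at
`0` of `x ↦ a * exp (ρ * x)`. -/
noncomputable def geomSeries (a ρ : K) : K⟦X⟧ :=
  PowerSeries.mk fun q => a * ρ ^ q

theorem coeff_geomSeries (a ρ : K) (q : ℕ) : coeff q (geomSeries a ρ) = a * ρ ^ q :=
  coeff_mk _ _

theorem geomSeries_eq_C_add (a ρ : K) : geomSeries a ρ = C a + C ρ * (X * geomSeries a ρ) := by
  ext q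
  rcases q with - | q
  · simp [coeff_geomSeries]
  · rw [map_add, coeff_C_mul, coeff_succ_X_mul, coeff_geomSeries, coeff_geomSeries, coeff_C,
      if_neg q.succ_ne_zero]
    ring

theorem scaleDensity_geomSeries (c a ρ : K) :
    scaleDensity c (geomSeries a ρ) = geomSeries (c * a) (c * ρ) := by
  ext q
  rw [scaleDensity, coeff_C_mul, coeff_rescale, coeff_geomSeries, coeff_geomSeries]
  ring

variable [CharZero K]

theorem derivative_borelTransform_X_mul_geomSeries (a ρ : K) :
    d⁄dX K (borelTransform (X * geomSeries a ρ)) =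
      C ρ * borelTransform (X * geomSeries a ρ) + C a := by
  conv_lhs =>
    rw [derivative_borelTransform_X_mul, geomSeries_eq_C_add, map_add, borelTransform_C_mul,
      borelTransform_C]
  ring

theorem derivative_borelTransform_mul_X_mul_scaleDensity_geomSeries (c a ρ : K) (A : K⟦X⟧) :
    d⁄dX K (borelTransform (A * (X * scaleDensity c (geomSeries a ρ)))) =
      C (c * ρ) * borelTransform (A * (X * scaleDensity c (geomSeries a ρ))) +
        C (c * a) * borelTransform A := by
  rw [scaleDensity_geomSeries, ← borelTransform_C_mul, ← borelTransform_C_mul, ← map_add,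
    mul_left_comm, derivative_borelTransform_X_mul]
  congr 1
  conv_lhs => rw [geomSeries_eq_C_add]
  ring

-- Convolution with an exponential density turns the successive distribution functions `G i` into
-- solutions of first-order linear differential equations, each determined by its value at `0`.
theorem borelTransform_prod_X_mul_scaleDensity_geomSeries_eq {a ρ : K} {c : ℕ → K} {G : ℕ → K⟦X⟧}
    (hG : G 0 = 1) (hG0 : ∀ i, constantCoeff (G (i + 1)) = 0)
    (hG' : ∀ i, d⁄dX K (G (i + 1)) = C (c i * ρ) * G (i + 1) + C (c i * a) * G i) (k : ℕ) :
    borelTransform (∏ i ∈ Finset.range k, X * scaleDensity (c i) (geomSeries a ρ)) = G k := by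
  induction k with
  | zero => rw [Finset.prod_range_zero, borelTransform_one, hG]
  | succ k ih =>
    rw [Finset.prod_range_succ]
    refine eq_of_derivative_eq_C_mul_add
      (derivative_borelTransform_mul_X_mul_scaleDensity_geomSeries _ _ _ _)
      (by rw [ih, hG' k]) ?_
    rw [hG0, mul_left_comm, constantCoeff_borelTransform_X_mul]

end GeometricSeries

section RenyiIdentity

variable {K : Type*} [Field K]

/-- The identity between formal series that expresses the equality in law of
`X_1 / n + X_2 / (n - 1) + ⋯ + X_k / (n - k + 1)` and the `k`-th order statistic of
`X_1, …, X_n`, where `Φ` is the series of derivatives at `0` of the common density. -/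
def IsRenyiSolution (n k : ℕ) (Φ : K⟦X⟧) : Prop :=
  borelTransform (∏ i ∈ Finset.range k, X * scaleDensity ((n : K) - i) Φ) =
    Polynomial.aeval (borelTransform (X * Φ)) (binomialTail K n k)

theorem isRenyiSolution_geomSeries_neg [CharZero K] (a : K) (n k : ℕ) :
    IsRenyiSolution n k (geomSeries a (-a)) := by
  set F := borelTransform (X * geomSeries a (-a)) with hF
  have hF' : d⁄dX K F = C a * (1 - F) := by
    rw [hF, derivative_borelTransform_X_mul_geomSeries, map_neg]
    ring
  refine borelTransform_prod_X_mul_scaleDensity_geomSeries_eq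
    (G := fun i => Polynomial.aeval F (binomialTail K n i)) ?_ (fun i => ?_) (fun i => ?_) k
  · rw [binomialTail_zero, map_one]
  · obtain ⟨W, hW⟩ := X_pow_dvd_binomialTail K n (i + 1)
    rw [constantCoeff_aeval, hF, constantCoeff_borelTransform_X_mul, hW]
    simp
  · have h := congrArg (Polynomial.aeval F) (one_sub_X_mul_derivative_binomialTail K n i)
    rw [eq_sub_of_add_eq (binomialTail_eq_add K n i).symm] at h
    simp only [map_mul, map_sub, map_one, map_natCast, Polynomial.aeval_X] at h
    rw [Derivation.map_aeval, smul_eq_mul, hF']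
    simp only [map_mul, map_sub, map_neg, map_natCast]
    linear_combination C a * h

theorem isRenyiSolution_geomSeries_self [CharZero K] (a ρ : K) (n : ℕ) :
    IsRenyiSolution n n (geomSeries a ρ) := by
  have hrefl : ∏ i ∈ Finset.range n, X * scaleDensity ((n : K) - i) (geomSeries a ρ) =
      ∏ i ∈ Finset.range n, X * scaleDensity ((i : K) + 1) (geomSeries a ρ) := by
    rw [← Finset.prod_range_reflect]
    refine Finset.prod_congr rfl fun i hi => ?_
    have := Finset.mem_range.1 hi
    rw [show n - 1 - i = n - (i + 1) by omega, Nat.cast_sub (by omega)]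
    push_cast
    ring_nf
  rw [IsRenyiSolution, hrefl, binomialTail_self, map_pow, Polynomial.aeval_X]
  refine borelTransform_prod_X_mul_scaleDensity_geomSeries_eq
    (G := fun i => borelTransform (X * geomSeries a ρ) ^ i) (pow_zero _) (fun i => ?_)
    (fun i => ?_) n
  · rw [map_pow, constantCoeff_borelTransform_X_mul, zero_pow i.succ_ne_zero]
  · rw [derivative_pow, derivative_borelTransform_X_mul_geomSeries]
    simp only [map_mul, map_add, map_one, map_natCast, Nat.cast_add, Nat.cast_one,
      Nat.add_sub_cancel]
    ring

theorem prod_range_cast_sub_eq_descFactorial {R : Type*} [CommRing R] (n k : ℕ) :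
    ∏ i ∈ Finset.range k, ((n : R) - i) = n.descFactorial k := by
  rw [← descPochhammer_eval_eq_prod_range, descPochhammer_eval_eq_descFactorial]

theorem prod_X_mul_scaleDensity_X_pow_mul (c : ℕ → K) (r k : ℕ) (U : K⟦X⟧) :
    ∏ i ∈ Finset.range k, X * scaleDensity (c i) (X ^ r * U) =
      X ^ (k * (r + 1)) *
        (C ((∏ i ∈ Finset.range k, c i) ^ (r + 1)) * ∏ i ∈ Finset.range k, rescale (c i) U) := by
  rw [mul_comm k, pow_mul, ← Finset.prod_pow, map_prod, ← Finset.prod_mul_distrib]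
  conv_rhs => rw [← Finset.card_range k, ← Finset.prod_const, Finset.card_range,
    ← Finset.prod_mul_distrib]
  refine Finset.prod_congr rfl fun i _ => ?_
  rw [scaleDensity, map_mul, map_pow, rescale_X, map_pow]
  ring

theorem IsRenyiSolution.descFactorial_pow_mul_eq [CharZero K] {n k r : ℕ} {U : K⟦X⟧}
    (hU : constantCoeff U ≠ 0) (h : IsRenyiSolution n k (X ^ r * U)) :
    n.descFactorial k ^ (r + 1) * (r + 1)! ^ k = n.choose k * (k * (r + 1))! := by
  obtain ⟨V, hV, hVq⟩ := exists_borelTransform_X_pow_mul_eq (r + 1) U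
  have hV0 : constantCoeff V = constantCoeff U / (r + 1)! := by simpa using hVq 0
  obtain ⟨W, hW, hW0⟩ := exists_binomialTail_eq_X_pow_mul K n k
  have hL : coeff (k * (r + 1)) (borelTransform
      (∏ i ∈ Finset.range k, X * scaleDensity ((n : K) - i) (X ^ r * U))) =
      n.descFactorial k ^ (r + 1) * constantCoeff U ^ k / (k * (r + 1))! := by
    rw [coeff_borelTransform, prod_X_mul_scaleDensity_X_pow_mul, coeff_X_pow_mul_self, map_mul,
      constantCoeff_C, prod_range_cast_sub_eq_descFactorial, map_prod]
    simp only [constantCoeff_rescale, Finset.prod_const, Finset.card_range]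
  have hR : coeff (k * (r + 1)) (Polynomial.aeval (borelTransform (X * (X ^ r * U)))
      (binomialTail K n k)) = n.choose k * (constantCoeff U / (r + 1)!) ^ k := by
    rw [← mul_assoc, ← pow_succ', hV, hW, map_mul, map_pow, Polynomial.aeval_X, mul_pow, ← pow_mul,
      mul_comm (r + 1) k, mul_assoc, coeff_X_pow_mul_self, map_mul, map_pow, hV0,
      constantCoeff_aeval, map_mul, map_pow, constantCoeff_X, zero_pow r.succ_ne_zero, zero_mul,
      hW0, mul_comm]
  have hLR := congrArg (coeff (k * (r + 1))) h
  have hne (N : ℕ) : (N ! : K) ≠ 0 := mod_cast N.factorial_ne_zero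
  rw [hL, hR, div_pow, mul_div_assoc', div_eq_div_iff (hne _) (pow_ne_zero k (hne _)),
    mul_right_comm, mul_right_comm _ (constantCoeff U ^ k)] at hLR
  exact_mod_cast mul_right_cancel₀ (pow_ne_zero k hU) hLR

theorem IsRenyiSolution.constantCoeff_ne_zero [CharZero K] {n k : ℕ} (hn : 2 ≤ n) (hk : 1 ≤ k)
    (hkn : k ≤ n) {Φ : K⟦X⟧} (hΦ : Φ ≠ 0) (h : IsRenyiSolution n k Φ) :
    constantCoeff Φ ≠ 0 := by
  obtain ⟨r, U, hU, rfl⟩ := exists_constantCoeff_ne_zero_and_eq_X_pow_mul hΦ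
  rcases Nat.eq_zero_or_pos r with rfl | hr
  · simpa using hU
  refine absurd ?_ (descFactorial_pow_mul_ne_factorial hn hk hr)
  refine Nat.eq_of_mul_eq_mul_left (Nat.choose_pos hkn) ?_
  rw [← h.descFactorial_pow_mul_eq hU, pow_succ]
  nth_rw 3 [Nat.descFactorial_eq_factorial_mul_choose]
  ring

theorem coeff_borelTransform_prod_X_mul_scaleDensity_sub {m : ℕ} (hm : m ≠ 0) {Φ Ψ : K⟦X⟧}
    (hΦΨ : X ^ m ∣ Φ - Ψ) (c : ℕ → K) (k : ℕ) :
    coeff (m + k) (borelTransform (∏ i ∈ Finset.range k, X * scaleDensity (c i) Φ) -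
        borelTransform (∏ i ∈ Finset.range k, X * scaleDensity (c i) Ψ)) =
      (∏ i ∈ Finset.range k, c i) * (∑ i ∈ Finset.range k, c i ^ m) * coeff m (Φ - Ψ) *
        constantCoeff Φ ^ (k - 1) / (m + k)! := by
  have hprod (Θ : K⟦X⟧) : ∏ i ∈ Finset.range k, X * scaleDensity (c i) Θ =
      X ^ k * (C (∏ i ∈ Finset.range k, c i) * ∏ i ∈ Finset.range k, rescale (c i) Θ) := by
    simpa using prod_X_mul_scaleDensity_X_pow_mul c 0 k Θ
  have hdvd (i : ℕ) : X ^ m ∣ rescale (c i) Φ - rescale (c i) Ψ := by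
    rw [← map_sub, X_pow_dvd_iff]
    intro q hq
    rw [coeff_rescale, X_pow_dvd_iff.1 hΦΨ q hq, mul_zero]
  rw [← map_sub, coeff_borelTransform, hprod, hprod, ← mul_sub, ← mul_sub, coeff_X_pow_mul,
    coeff_C_mul, coeff_prod_sub_prod _ hm (fun i _ => hdvd i)
      (fun i _ => constantCoeff_rescale (c i) Φ), Finset.card_range]
  simp only [← map_sub, coeff_rescale, ← Finset.sum_mul]
  ring

theorem coeff_aeval_borelTransform_binomialTail_sub {m : ℕ} (hm : m ≠ 0) {Φ Ψ : K⟦X⟧}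
    (hΦΨ : X ^ m ∣ Φ - Ψ) (n k : ℕ) :
    coeff (m + k) (Polynomial.aeval (borelTransform (X * Φ)) (binomialTail K n k) -
        Polynomial.aeval (borelTransform (X * Ψ)) (binomialTail K n k)) =
      n.choose k * k * coeff m (Φ - Ψ) * constantCoeff Φ ^ (k - 1) / (m + 1)! := by
  obtain ⟨A, hA, hAq⟩ := exists_borelTransform_X_pow_mul_eq 1 Φ
  obtain ⟨B, hB, hBq⟩ := exists_borelTransform_X_pow_mul_eq 1 Ψ
  obtain ⟨W, hW, hW0⟩ := exists_binomialTail_eq_X_pow_mul K n k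
  rw [pow_one] at hA hB
  have hsub (q : ℕ) : coeff q (A - B) = coeff q (Φ - Ψ) / (q + 1)! := by
    rw [map_sub, map_sub, hAq, hBq, sub_div]
  have hdvd : X ^ m ∣ A - B := X_pow_dvd_iff.2 fun q hq => by
    rw [hsub, X_pow_dvd_iff.1 hΦΨ q hq, zero_div]
  have hA0 : constantCoeff A = constantCoeff Φ := by simpa using hAq 0
  rw [hA, hB, hW, coeff_aeval_X_pow_mul_sub hm hdvd, hsub, hW0, hA0]
  ring

theorem IsRenyiSolution.sum_pow_mul_coeff_sub_eq [CharZero K] {n k m : ℕ} (hk : 1 ≤ k)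
    (hkn : k ≤ n) (hm : m ≠ 0) {Φ Ψ : K⟦X⟧} (hΦ : IsRenyiSolution n k Φ)
    (hΨ : IsRenyiSolution n k Ψ) (h0 : constantCoeff Φ ≠ 0) (hΦΨ : X ^ m ∣ Φ - Ψ) :
    (∑ i ∈ Finset.range k, (n - i) ^ m : ℕ) * coeff m (Φ - Ψ) =
      (m + k).choose (m + 1) * coeff m (Φ - Ψ) := by
  have h := congrArg (coeff (m + k)) (congrArg₂ (· - ·) hΦ hΨ)
  rw [coeff_borelTransform_prod_X_mul_scaleDensity_sub hm hΦΨ,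
    coeff_aeval_borelTransform_binomialTail_sub hm hΦΨ, prod_range_cast_sub_eq_descFactorial] at h
  have hsum : ((∑ i ∈ Finset.range k, (n - i) ^ m : ℕ) : K) =
      ∑ i ∈ Finset.range k, ((n : K) - i) ^ m := by
    push_cast
    refine Finset.sum_congr rfl fun i hi => ?_
    rw [Nat.cast_sub ((Finset.mem_range.1 hi).le.trans hkn)]
  have hdesc : (n.descFactorial k : K) = k * (k - 1)! * n.choose k := by
    rw [Nat.descFactorial_eq_factorial_mul_choose, ← Nat.mul_factorial_pred (by omega : k ≠ 0)]
    push_cast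
    ring
  have hchoose : ((m + k).choose (m + 1) * (m + 1)! * (k - 1)! : K) = (m + k)! := by
    have := Nat.choose_mul_factorial_mul_factorial (show m + 1 ≤ m + k by omega)
    rw [show m + k - (m + 1) = k - 1 by omega] at this
    exact_mod_cast this
  have hne (N : ℕ) : (N ! : K) ≠ 0 := mod_cast N.factorial_ne_zero
  have hk0 : (k : K) ≠ 0 := by exact_mod_cast (by omega : k ≠ 0)
  have hnk : (n.choose k : K) ≠ 0 := mod_cast (Nat.choose_pos hkn).ne'
  rw [← hsum, hdesc, div_eq_div_iff (hne _) (hne _), ← hchoose] at h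
  refine mul_left_cancel₀ (mul_ne_zero (mul_ne_zero (mul_ne_zero (mul_ne_zero hk0 hnk)
    (hne (k - 1))) (hne (m + 1))) (pow_ne_zero (k - 1) h0)) ?_
  linear_combination h

theorem IsRenyiSolution.coeff_eq_of_X_pow_dvd_sub [CharZero K] {n k m : ℕ} (hk : 1 ≤ k)
    (hm : 1 ≤ m) (hnkm : k < n ∨ k = n ∧ 2 ≤ n ∧ 2 ≤ m) {Φ Ψ : K⟦X⟧}
    (hΦ : IsRenyiSolution n k Φ) (hΨ : IsRenyiSolution n k Ψ) (h0 : constantCoeff Φ ≠ 0)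
    (hΦΨ : X ^ m ∣ Φ - Ψ) : coeff m Φ = coeff m Ψ := by
  by_contra hne
  have hkn : k ≤ n := by omega
  have h := hΦ.sum_pow_mul_coeff_sub_eq hk hkn (by omega) hΨ h0 hΦΨ
  have h := mul_right_cancel₀ (by rwa [map_sub, sub_ne_zero]) h
  exact (choose_succ_lt_sum_range_sub_pow hk hm hnkm).ne' (mod_cast h)

theorem IsRenyiSolution.eq [CharZero K] {n k : ℕ} (hn : 2 ≤ n) (hk : 1 ≤ k) (hkn : k ≤ n)
    {Φ Ψ : K⟦X⟧} (hΦ : IsRenyiSolution n k Φ) (hΨ : IsRenyiSolution n k Ψ)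
    (h0 : constantCoeff Φ ≠ 0) (hΨ0 : constantCoeff Φ = constantCoeff Ψ)
    (hΨ1 : k = n → coeff 1 Φ = coeff 1 Ψ) : Φ = Ψ := by
  ext q
  induction q using Nat.strong_induction_on with
  | _ q ih =>
    rcases Nat.eq_zero_or_pos q with rfl | hq
    · simpa using hΨ0
    by_cases hq1 : k = n ∧ q = 1
    · rw [hq1.2]
      exact hΨ1 hq1.1
    · refine hΦ.coeff_eq_of_X_pow_dvd_sub hk hq (by omega) hΨ h0 (X_pow_dvd_iff.2 fun p hp => ?_)
      rw [map_sub, ih p hp, sub_self]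

theorem IsRenyiSolution.exists_eq_geomSeries [CharZero K] {n k : ℕ} (hn : 2 ≤ n) (hk : 1 ≤ k)
    (hkn : k ≤ n) {Φ : K⟦X⟧} (hΦ : Φ ≠ 0) (h : IsRenyiSolution n k Φ) :
    ∃ a ρ : K, Φ = geomSeries a ρ := by
  have h0 := h.constantCoeff_ne_zero hn hk hkn hΦ
  have hgeom0 (ρ : K) : constantCoeff Φ = constantCoeff (geomSeries (constantCoeff Φ) ρ) := by
    rw [← coeff_zero_eq_constantCoeff_apply (geomSeries _ _), coeff_geomSeries, pow_zero, mul_one]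
  rcases hkn.lt_or_eq with hlt | rfl
  · exact ⟨_, _, h.eq hn hk hkn (isRenyiSolution_geomSeries_neg (constantCoeff Φ) n k) h0
      (hgeom0 _) fun hkn => absurd hkn hlt.ne⟩
  · refine ⟨_, coeff 1 Φ / constantCoeff Φ, h.eq hn hk hkn
      (isRenyiSolution_geomSeries_self _ _ k) h0 (hgeom0 _) fun _ => ?_⟩
    rw [coeff_geomSeries, pow_one, mul_div_cancel₀ _ h0]

end RenyiIdentity

section MaclaurinSeries

/-- The function `g` is the sum of the power series `A` at every positive real. -/
def HasMaclaurinSeries (g : ℝ → ℝ) (A : ℝ⟦X⟧) : Prop :=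
  ∀ x, 0 < x → HasSum (fun q => coeff q A * x ^ q) (g x)

theorem integral_sub_pow_mul_pow (x : ℝ) (i j : ℕ) :
    ∫ y in (0 : ℝ)..x, (x - y) ^ i * y ^ j = i ! * j ! / (i + j + 1)! * x ^ (i + j + 1) := by
  induction i generalizing j with
  | zero =>
    simp only [pow_zero, one_mul, integral_pow, zero_add, Nat.factorial_succ, Nat.factorial_zero]
    have : (j ! : ℝ) ≠ 0 := by positivity
    push_cast
    field_simp
    simp
  | succ i ih =>
    have hu (y : ℝ) : HasDerivAt (fun y : ℝ => (x - y) ^ (i + 1)) (-((i + 1) * (x - y) ^ i)) y := by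
      simpa using! ((hasDerivAt_id y).const_sub x).pow (i + 1)
    have hv (y : ℝ) : HasDerivAt (fun y : ℝ => y ^ (j + 1) / (j + 1)) (y ^ j) y := by
      have h := (hasDerivAt_pow (j + 1) y).div_const (j + 1 : ℝ)
      rwa [Nat.cast_succ, Nat.add_sub_cancel, mul_div_cancel_left₀ _ (by positivity)] at h
    have hparts (y : ℝ) : -((i + 1) * (x - y) ^ i) * (y ^ (j + 1) / (j + 1)) =
        -((i + 1) / (j + 1)) * ((x - y) ^ i * y ^ (j + 1)) := by ring
    rw [intervalIntegral.integral_mul_deriv_eq_deriv_mul (fun y _ => hu y) (fun y _ => hv y)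
      (Continuous.intervalIntegrable (by fun_prop) _ _)
      (Continuous.intervalIntegrable (by fun_prop) _ _)]
    simp only [hparts, intervalIntegral.integral_const_mul, ih]
    rw [show i + (j + 1) + 1 = i + 1 + j + 1 by ring, Nat.factorial_succ i, Nat.factorial_succ j]
    have : ((i + 1 + j + 1)! : ℝ) ≠ 0 := by positivity
    push_cast
    field_simp
    simp

theorem setIntegral_Ioo_sub_pow_mul_pow {x : ℝ} (hx : 0 ≤ x) (i j : ℕ) :
    ∫ y in Set.Ioo 0 x, (x - y) ^ i * y ^ j = i ! * j ! / (i + j + 1)! * x ^ (i + j + 1) := by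
  rw [← integral_sub_pow_mul_pow, intervalIntegral.integral_of_le hx, integral_Ioc_eq_integral_Ioo]

theorem factorial_mul_factorial_div_factorial_le_one (i j : ℕ) :
    (i ! * j ! / (i + j + 1)! : ℝ) ≤ 1 := by
  rw [div_le_one (by positivity)]
  exact_mod_cast (Nat.le_of_dvd (Nat.factorial_pos _)
    (Nat.factorial_mul_factorial_dvd_factorial_add i j)).trans (Nat.factorial_le (Nat.le_succ _))

namespace HasMaclaurinSeries

variable {g h : ℝ → ℝ} {A B : ℝ⟦X⟧}

theorem congr (hg : HasMaclaurinSeries g A) (hgh : ∀ x, 0 < x → h x = g x) :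
    HasMaclaurinSeries h A :=
  fun x hx => (hgh x hx).symm ▸ hg x hx

theorem summable_norm (hg : HasMaclaurinSeries g A) {x : ℝ} (hx : 0 < x) :
    Summable fun q => ‖coeff q A * x ^ q‖ :=
  (hg x hx).summable.norm

theorem const (r : ℝ) : HasMaclaurinSeries (fun _ => r) (C r) := fun x _ => by
  simpa using hasSum_single (f := fun q => coeff q (C r) * x ^ q) 0
    fun q hq => by rw [coeff_C, if_neg hq, zero_mul]

theorem add (hg : HasMaclaurinSeries g A) (hh : HasMaclaurinSeries h B) :
    HasMaclaurinSeries (fun x => g x + h x) (A + B) := fun x hx => by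
  simpa only [map_add, add_mul] using (hg x hx).add (hh x hx)

theorem sub (hg : HasMaclaurinSeries g A) (hh : HasMaclaurinSeries h B) :
    HasMaclaurinSeries (fun x => g x - h x) (A - B) := fun x hx => by
  simpa only [map_sub, sub_mul] using (hg x hx).sub (hh x hx)

theorem mul (hg : HasMaclaurinSeries g A) (hh : HasMaclaurinSeries h B) :
    HasMaclaurinSeries (fun x => g x * h x) (A * B) := fun x hx => by
  have hsum := summable_norm_sum_mul_antidiagonal_of_summable_norm
    (hg.summable_norm hx) (hh.summable_norm hx)
  have htsum := tsum_mul_tsum_eq_tsum_sum_antidiagonal_of_summable_norm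
    (hg.summable_norm hx) (hh.summable_norm hx)
  rw [(hg x hx).tsum_eq, (hh x hx).tsum_eq] at htsum
  simp only [htsum]
  refine HasSum.congr_fun hsum.of_norm.hasSum fun q => ?_
  rw [coeff_mul, Finset.sum_mul]
  refine Finset.sum_congr rfl fun p hp => ?_
  rw [← Finset.HasAntidiagonal.mem_antidiagonal.1 hp]
  ring

theorem aeval (hg : HasMaclaurinSeries g A) (P : Polynomial ℝ) :
    HasMaclaurinSeries (fun x => P.eval (g x)) (Polynomial.aeval A P) := by
  induction P using Polynomial.induction_on' with
  | add p q hp hq => simpa using hp.add hq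
  | monomial n r =>
    simp only [Polynomial.eval_monomial, Polynomial.aeval_monomial]
    refine (const r).mul ?_
    induction n with
    | zero => simpa using const 1
    | succ n ih => simpa only [pow_succ] using ih.mul hg

theorem scale {c : ℝ} (hc : 0 < c) (hg : HasMaclaurinSeries g (borelTransform A)) :
    HasMaclaurinSeries (fun x => c * g (c * x)) (borelTransform (scaleDensity c A)) :=
  fun x hx => by
    refine HasSum.congr_fun ((hg (c * x) (by positivity)).mul_left c) fun q => ?_
    rw [coeff_borelTransform, scaleDensity, coeff_C_mul, coeff_rescale, coeff_borelTransform]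
    ring

theorem eq_zero (hA : HasMaclaurinSeries (fun _ => 0) A) : A = 0 := by
  set p := FormalMultilinearSeries.ofScalars ℝ fun q => coeff q A with hp
  have hradius : 1 ≤ p.radius := p.le_radius_of_summable (r := 1) <| by
    simpa [hp, FormalMultilinearSeries.ofScalars_norm] using hA.summable_norm one_pos
  have hseries : HasFPowerSeriesAt p.sum p 0 :=
    (p.hasFPowerSeriesOnBall (one_pos.trans_le hradius)).hasFPowerSeriesAt
  have hpos : ∀ᶠ x in nhdsWithin (0 : ℝ) (Set.Ioi 0), p.sum x = 0 := by
    filter_upwards [self_mem_nhdsWithin] with x hx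
    exact (FormalMultilinearSeries.ofScalars_sum_eq _ x).trans (hA x hx).tsum_eq
  have hzero : ∀ᶠ x in nhds 0, p.sum x = 0 :=
    hseries.analyticAt.frequently_zero_iff_eventually_zero.1
      (hpos.frequently.filter_mono (nhdsWithin_mono 0 fun _ hx => ne_of_gt hx))
  have := (FormalMultilinearSeries.ofScalars_series_eq_zero ℝ).1
    (hseries.congr hzero).eq_zero
  ext q
  exact congrFun this q

theorem unique (hA : HasMaclaurinSeries g A) (hB : HasMaclaurinSeries g B) : A = B :=
  sub_eq_zero.1 ((hA.sub hB).congr fun x _ => (sub_self (g x)).symm).eq_zero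

theorem summable_integral_norm_sub_pow_mul_pow (hg : HasMaclaurinSeries g A)
    (hh : HasMaclaurinSeries h B) {x : ℝ} (hx : 0 < x) :
    Summable fun p : ℕ × ℕ =>
      ∫ y in Set.Ioo 0 x, ‖coeff p.1 A * (x - y) ^ p.1 * (coeff p.2 B * y ^ p.2)‖ := by
  have hnorm (p : ℕ × ℕ) :
      ∫ y in Set.Ioo 0 x, ‖coeff p.1 A * (x - y) ^ p.1 * (coeff p.2 B * y ^ p.2)‖ =
        ‖coeff p.1 A‖ * ‖coeff p.2 B‖ *
          (p.1 ! * p.2 ! / (p.1 + p.2 + 1)! * x ^ (p.1 + p.2 + 1)) := by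
    rw [← setIntegral_Ioo_sub_pow_mul_pow hx.le, ← integral_const_mul]
    refine setIntegral_congr_fun measurableSet_Ioo fun y hy => ?_
    simp only [norm_mul, norm_pow]
    rw [Real.norm_of_nonneg hy.1.le, Real.norm_of_nonneg (sub_nonneg.2 hy.2.le)]
    ring
  have hsum := ((hg.summable_norm hx).mul_of_nonneg (hh.summable_norm hx)
    (fun _ => norm_nonneg _) (fun _ => norm_nonneg _)).mul_right x
  refine hsum.of_nonneg_of_le (fun p => integral_nonneg fun _ => norm_nonneg _) fun p => ?_
  rw [hnorm]
  simp only [norm_mul, norm_pow, Real.norm_of_nonneg hx.le]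
  calc _ ≤ ‖coeff p.1 A‖ * ‖coeff p.2 B‖ * (1 * x ^ (p.1 + p.2 + 1)) := by
        gcongr
        exact factorial_mul_factorial_div_factorial_le_one _ _
    _ = _ := by ring

theorem hasSum_setIntegral_Ioo_sub_mul (hg : HasMaclaurinSeries g A)
    (hh : HasMaclaurinSeries h B) {x : ℝ} (hx : 0 < x) :
    HasSum (fun p : ℕ × ℕ => coeff p.1 A * coeff p.2 B *
        (p.1 ! * p.2 ! / (p.1 + p.2 + 1)! * x ^ (p.1 + p.2 + 1)))
      (∫ y in Set.Ioo 0 x, g (x - y) * h y) := by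
  have hint (p : ℕ × ℕ) : IntegrableOn
      (fun y => coeff p.1 A * (x - y) ^ p.1 * (coeff p.2 B * y ^ p.2)) (Set.Ioo 0 x) :=
    (Continuous.integrableOn_Icc (by fun_prop)).mono_set Set.Ioo_subset_Icc_self
  have htsum : ∫ y in Set.Ioo 0 x, g (x - y) * h y = ∫ y in Set.Ioo 0 x,
      ∑' p : ℕ × ℕ, coeff p.1 A * (x - y) ^ p.1 * (coeff p.2 B * y ^ p.2) := by
    refine setIntegral_congr_fun measurableSet_Ioo fun y hy => ?_
    have hxy : 0 < x - y := sub_pos.2 hy.2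
    exact ((hg _ hxy).mul (hh y hy.1) (summable_mul_of_summable_norm (hg.summable_norm hxy)
      (hh.summable_norm hy.1))).tsum_eq.symm
  rw [htsum]
  refine HasSum.congr_fun (hasSum_integral_of_summable_integral_norm hint
    (hg.summable_integral_norm_sub_pow_mul_pow hh hx)) fun p => ?_
  rw [← setIntegral_Ioo_sub_pow_mul_pow hx.le, ← integral_const_mul]
  congr with y
  ring

theorem convolution (hg : HasMaclaurinSeries g (borelTransform A))
    (hh : HasMaclaurinSeries h (borelTransform B)) :
    HasMaclaurinSeries (fun x => ∫ y in Set.Ioo 0 x, g (x - y) * h y)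
      (borelTransform (A * (X * B))) := fun x hx => by
  have hsigma := (Finset.HasAntidiagonal.sigmaAntidiagonalEquivProd (A := ℕ)).hasSum_iff.2
    (hg.hasSum_setIntegral_Ioo_sub_mul hh hx)
  rw [← hasSum_nat_add_iff' 1, Finset.sum_range_one, mul_left_comm,
    coeff_zero_eq_constantCoeff_apply, constantCoeff_borelTransform_X_mul, zero_mul, sub_zero]
  refine HasSum.congr_fun (hsigma.sigma fun q => hasSum_fintype _) fun q => ?_
  simp only [Function.comp, Finset.HasAntidiagonal.sigmaAntidiagonalEquivProd_apply]
  rw [Finset.univ_eq_attach, Finset.sum_attach (Finset.HasAntidiagonal.antidiagonal q)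
    (fun p => coeff p.1 (borelTransform A) * coeff p.2 (borelTransform B) *
      (p.1 ! * p.2 ! / (p.1 + p.2 + 1)! * x ^ (p.1 + p.2 + 1))),
    coeff_borelTransform, coeff_succ_X_mul, coeff_mul, Finset.sum_div, Finset.sum_mul]
  refine Finset.sum_congr rfl fun p hp => ?_
  have hne (N : ℕ) : (N ! : ℝ) ≠ 0 := by positivity
  rw [Finset.HasAntidiagonal.mem_antidiagonal.1 hp, coeff_borelTransform, coeff_borelTransform]
  field_simp [hne p.1, hne p.2]

end HasMaclaurinSeries

end MaclaurinSeries

section OrderStatistic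

theorem setOf_filter_le_eq_univ_pi {ι : Type*} [Fintype ι] [DecidableEq ι] (t : ℝ)
    (A : Finset ι) :
    {x : ι → ℝ | Finset.univ.filter (x · ≤ t) = A} =
      Set.univ.pi fun i => if i ∈ A then Set.Iic t else Set.Ioi t := by
  ext x
  rw [Set.mem_ofPred_eq, Set.mem_univ_pi, Finset.ext_iff]
  refine forall_congr' fun i => ?_
  by_cases h : i ∈ A <;> simp [h]

theorem measurableSet_setOf_filter_le_eq {ι : Type*} [Fintype ι] (t : ℝ) (A : Finset ι) :
    MeasurableSet {x : ι → ℝ | Finset.univ.filter (x · ≤ t) = A} := by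
  classical
  rw [setOf_filter_le_eq_univ_pi]
  refine MeasurableSet.univ_pi fun i => ?_
  split_ifs
  exacts [measurableSet_Iic, measurableSet_Ioi]

theorem pi_real_setOf_filter_le_eq {ι : Type*} [Fintype ι] (μ : Measure ℝ)
    [IsProbabilityMeasure μ] (t : ℝ) (A : Finset ι) :
    (Measure.pi fun _ : ι => μ).real {x | Finset.univ.filter (x · ≤ t) = A} =
      cdf μ t ^ A.card * (1 - cdf μ t) ^ (Fintype.card ι - A.card) := by
  classical
  have hfactor (i : ι) : (μ (if i ∈ A then Set.Iic t else Set.Ioi t)).toReal =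
      if i ∈ A then cdf μ t else 1 - cdf μ t := by
    rw [← measureReal_def, cdf_eq_real, ← probReal_compl_eq_one_sub measurableSet_Iic,
      Set.compl_Iic]
    split_ifs <;> rfl
  rw [setOf_filter_le_eq_univ_pi, measureReal_def, Measure.pi_pi, ENNReal.toReal_prod]
  simp only [hfactor]
  rw [Finset.prod_ite]
  simp [Finset.filter_not, Finset.card_sdiff]

variable {n : ℕ}

theorem orderStatistic_le_iff (x : Fin n → ℝ) (i : Fin n) (t : ℝ) :
    orderStatistic x i ≤ t ↔ (i : ℕ) < (Finset.univ.filter (x · ≤ t)).card := by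
  have hcard : (Finset.univ.filter (x · ≤ t)).card =
      (Finset.univ.filter ((x ∘ Tuple.sort x) · ≤ t)).card := by
    rw [← Finset.card_map (Tuple.sort x).symm.toEmbedding]
    congr 1
    ext j
    simp
  rw [orderStatistic, ← Function.comp_apply (f := x),
    ← Tuple.lt_card_le_iff_apply_le_of_monotone (Tuple.monotone_sort x), hcard]

theorem setOf_orderStatistic_le (i : Fin n) (t : ℝ) :
    {x : Fin n → ℝ | orderStatistic x i ≤ t} =
      ⋃ A ∈ Finset.univ.filter (fun A : Finset (Fin n) => (i : ℕ) < A.card),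
        {x | Finset.univ.filter (x · ≤ t) = A} := by
  ext x
  simp [orderStatistic_le_iff]

theorem measurable_orderStatistic (i : Fin n) :
    Measurable fun x : Fin n → ℝ => orderStatistic x i := by
  refine measurable_of_Iic fun t => ?_
  change MeasurableSet {x : Fin n → ℝ | orderStatistic x i ≤ t}
  rw [setOf_orderStatistic_le]
  exact Finset.measurableSet_biUnion _ fun A _ => measurableSet_setOf_filter_le_eq t A

theorem pi_real_setOf_orderStatistic_le (μ : Measure ℝ) [IsProbabilityMeasure μ] (i : Fin n)
    (t : ℝ) :
    (Measure.pi fun _ : Fin n => μ).real {x | orderStatistic x i ≤ t} =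
      (binomialTail ℝ n (i + 1)).eval (cdf μ t) := by
  have hdisj : Set.PairwiseDisjoint
      ↑(Finset.univ.filter fun A : Finset (Fin n) => (i : ℕ) < A.card)
      fun A => {x : Fin n → ℝ | Finset.univ.filter (x · ≤ t) = A} :=
    fun A _ B _ hAB => Set.disjoint_left.2 fun x hA hB => hAB (hA.symm.trans hB)
  rw [setOf_orderStatistic_le, measureReal_biUnion_finset hdisj
    fun A _ => measurableSet_setOf_filter_le_eq t A]
  simp only [pi_real_setOf_filter_le_eq, Fintype.card_fin]
  rw [Finset.sum_filter, ← Finset.powerset_univ,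
    Finset.sum_powerset_apply_card
      (fun j => if (i : ℕ) < j then cdf μ t ^ j * (1 - cdf μ t) ^ (n - j) else 0),
    binomialTail, Polynomial.eval_finsetSum, Finset.card_univ, Fintype.card_fin]
  simp only [smul_ite, smul_zero]
  rw [← Finset.sum_filter]
  refine Finset.sum_congr (by ext j; simp; omega) fun j _ => ?_
  simp [bernsteinPolynomial, mul_assoc]

theorem cdf_map_orderStatistic {Ω : Type*} [MeasurableSpace Ω] {P : Measure Ω}
    {μ : Measure ℝ} [IsProbabilityMeasure μ] {X : Fin n → Ω → ℝ}
    (hlaw : ∀ i, HasLaw (X i) μ P) (hindep : iIndepFun X P) (i : Fin n) (t : ℝ) :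
    cdf (P.map fun ω => orderStatistic (fun j => X j ω) i) t =
      (binomialTail ℝ n (i + 1)).eval (cdf μ t) := by
  have hX (j : Fin n) : AEMeasurable (X j) P := (hlaw j).aemeasurable
  have hpi : P.map (fun ω j => X j ω) = Measure.pi fun _ => μ := by
    have := hindep.isProbabilityMeasure
    rw [(iIndepFun_iff_map_fun_eq_pi_map hX).1 hindep]
    simp only [(hlaw _).map_eq]
  have hmap : P.map (fun ω => orderStatistic (fun j => X j ω) i) =
      (Measure.pi fun _ => μ).map fun x => orderStatistic x i := by
    rw [← hpi, AEMeasurable.map_map_of_aemeasurable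
      (measurable_orderStatistic i).aemeasurable (aemeasurable_pi_lambda _ hX)]
    rfl
  have := Measure.isProbabilityMeasure_map
    (μ := Measure.pi fun _ : Fin n => μ) (measurable_orderStatistic i).aemeasurable
  rw [hmap, cdf_eq_real, map_measureReal_apply (measurable_orderStatistic i) measurableSet_Iic]
  exact pi_real_setOf_orderStatistic_le μ i t

end OrderStatistic

section Density

theorem cdf_conv (ν μ : Measure ℝ) [IsProbabilityMeasure ν] [IsProbabilityMeasure μ] (x : ℝ) :
    cdf (ν ∗ μ) x = ∫ y, cdf ν (x - y) ∂μ := by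
  have hmeas : Measurable fun y => cdf ν (x - y) :=
    (monotone_cdf ν).measurable.comp (measurable_const.sub measurable_id)
  rw [cdf_eq_real, measureReal_def, Measure.conv, Measure.map_apply (by fun_prop)
    measurableSet_Iic, Measure.prod_apply_symm (measurableSet_Iic.preimage (by fun_prop)),
    integral_eq_lintegral_of_nonneg_ae (ae_of_all _ fun y => cdf_nonneg ν _)
      hmeas.aestronglyMeasurable]
  congr 1
  refine lintegral_congr fun y => ?_
  rw [ofReal_cdf]
  congr 1
  ext z
  simp [le_sub_iff_add_le]

/-- The law `μ` on the positive half-line has density `f`, and the coefficients of `Φ` are the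
derivatives of `f` at `0`. The density is normalised to vanish on `(-∞, 0]`. -/
structure IsPositiveDensity (μ : Measure ℝ) (f : ℝ → ℝ) (Φ : ℝ⟦X⟧) : Prop where
  measurable : Measurable f
  nonneg : ∀ x, 0 ≤ f x
  eq_zero : ∀ x ≤ 0, f x = 0
  eq_withDensity : μ = volume.withDensity fun x => ENNReal.ofReal (f x)
  hasMaclaurinSeries : HasMaclaurinSeries f (borelTransform Φ)

theorem HasMaclaurinDensity.exists_isPositiveDensity {μ : Measure ℝ} [IsProbabilityMeasure μ]
    (hμ : HasMaclaurinDensity μ) : ∃ f Φ, IsPositiveDensity μ f Φ := by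
  obtain ⟨f, hf, hf0, hμf, a, ha⟩ := hμ.density
  refine ⟨(Set.Ioi 0).indicator f, PowerSeries.mk fun q => q ! * a q,
    hf.indicator measurableSet_Ioi, fun x => Set.indicator_nonneg (fun x _ => hf0 x) x,
    fun x hx => Set.indicator_of_notMem (Set.notMem_Ioi.2 hx) f, ?_, fun x hx => ?_⟩
  · have hneg : μ (Set.Ioi 0)ᶜ = 0 := by
      rw [Set.compl_Ioi, ← ofReal_cdf, hμ.cdf_zero, ENNReal.ofReal_zero]
    have hrestrict : μ.restrict (Set.Ioi 0) = μ := Measure.restrict_eq_self_of_ae_mem hneg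
    have hindicator : (fun x => ENNReal.ofReal ((Set.Ioi 0).indicator f x)) =
        (Set.Ioi 0).indicator fun x => ENNReal.ofReal (f x) :=
      (Set.indicator_comp_of_zero ENNReal.ofReal_zero).symm
    rw [hindicator, withDensity_indicator measurableSet_Ioi,
      ← restrict_withDensity measurableSet_Ioi, ← hμf, hrestrict]
  · rw [Set.indicator_of_mem (Set.mem_Ioi.2 hx)]
    refine HasSum.congr_fun (ha x hx) fun q => ?_
    have : (q ! : ℝ) ≠ 0 := by positivity
    rw [coeff_borelTransform, coeff_mk]
    field_simp

/-- The law `ν` is carried by `[0, ∞)`, and the coefficients of `A` are the derivatives of its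
distribution function at `0`. An atom at `0` is allowed, so that `Measure.dirac 0` qualifies. -/
structure HasCdfSeries (ν : Measure ℝ) (A : ℝ⟦X⟧) : Prop where
  cdf_of_neg : ∀ x < 0, cdf ν x = 0
  hasMaclaurinSeries : HasMaclaurinSeries (cdf ν) (borelTransform A)

theorem hasCdfSeries_dirac_zero : HasCdfSeries (Measure.dirac 0) 1 where
  cdf_of_neg x hx := by
    rw [cdf_eq_real, measureReal_def, Measure.dirac_apply' _ measurableSet_Iic]
    simp [hx]
  hasMaclaurinSeries := by
    rw [borelTransform_one, ← map_one (C (R := ℝ))]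
    refine (HasMaclaurinSeries.const 1).congr fun x hx => ?_
    rw [cdf_eq_real, measureReal_def, Measure.dirac_apply' _ measurableSet_Iic]
    simp [hx.le]

namespace IsPositiveDensity

variable {μ ν : Measure ℝ} {f : ℝ → ℝ} {Φ A : ℝ⟦X⟧}

theorem map_div (hμ : IsPositiveDensity μ f Φ) {c : ℝ} (hc : 0 < c) :
    IsPositiveDensity (μ.map (· / c)) (fun y => c * f (c * y)) (scaleDensity c Φ) where
  measurable := (hμ.measurable.comp (measurable_const_mul c)).const_mul c
  nonneg y := mul_nonneg hc.le (hμ.nonneg _)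
  eq_zero y hy := by rw [hμ.eq_zero _ (mul_nonpos_of_nonneg_of_nonpos hc.le hy), mul_zero]
  eq_withDensity := by
    have hdiv : Measurable fun z : ℝ => z / c := measurable_id.div_const c
    have hderiv (x : ℝ) : HasDerivAt (c * ·) c x := hasDerivAt_const_mul c
    ext s hs
    have himage : (· / c) ⁻¹' s = (c * ·) '' s :=
      ((Equiv.mulLeft₀ c hc.ne').image_eq_preimage_symm s).symm ▸ by
        ext z; simp [div_eq_inv_mul]
    rw [Measure.map_apply hdiv hs, hμ.eq_withDensity, withDensity_apply _ (hdiv hs),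
      withDensity_apply _ hs, himage, lintegral_image_eq_lintegral_abs_deriv_mul hs
        (fun x _ => (hderiv x).hasDerivWithinAt)
        (mul_right_injective₀ hc.ne').injOn]
    simp only [abs_of_pos hc, ENNReal.ofReal_mul hc.le]
  hasMaclaurinSeries := hμ.hasMaclaurinSeries.scale hc

theorem integral_eq (hμ : IsPositiveDensity μ f Φ) (g : ℝ → ℝ) :
    ∫ y, g y ∂μ = ∫ y, g y * f y := by
  rw [hμ.eq_withDensity, integral_withDensity_eq_integral_toReal_smul
    hμ.measurable.ennreal_ofReal (ae_of_all _ fun _ => ENNReal.ofReal_lt_top)]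
  simp only [ENNReal.toReal_ofReal (hμ.nonneg _), smul_eq_mul, mul_comm]

variable [IsProbabilityMeasure μ]

theorem cdf_conv_eq_setIntegral (hμ : IsPositiveDensity μ f Φ) [IsProbabilityMeasure ν]
    (hν : ∀ x < 0, cdf ν x = 0) (x : ℝ) :
    cdf (ν ∗ μ) x = ∫ y in Set.Ioc 0 x, cdf ν (x - y) * f y := by
  rw [cdf_conv, hμ.integral_eq]
  refine (setIntegral_eq_integral_of_forall_compl_eq_zero fun y hy => ?_).symm
  rcases le_or_gt y 0 with hy0 | hy0
  · rw [hμ.eq_zero y hy0, mul_zero]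
  · have hxy : x < y := not_le.1 fun h => hy ⟨hy0, h⟩
    rw [hν (x - y) (sub_neg.2 hxy), zero_mul]

theorem hasCdfSeries_conv (hμ : IsPositiveDensity μ f Φ) [IsProbabilityMeasure ν]
    (hν : HasCdfSeries ν A) : HasCdfSeries (ν ∗ μ) (A * (X * Φ)) where
  cdf_of_neg x hx := by
    rw [hμ.cdf_conv_eq_setIntegral hν.cdf_of_neg, Set.Ioc_eq_empty hx.not_gt, setIntegral_empty]
  hasMaclaurinSeries :=
    (hν.hasMaclaurinSeries.convolution hμ.hasMaclaurinSeries).congr fun x _ => by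
      rw [hμ.cdf_conv_eq_setIntegral hν.cdf_of_neg, integral_Ioc_eq_integral_Ioo]

theorem hasCdfSeries (hμ : IsPositiveDensity μ f Φ) : HasCdfSeries μ (X * Φ) := by
  simpa only [Measure.dirac_zero_conv, one_mul] using hμ.hasCdfSeries_conv hasCdfSeries_dirac_zero

theorem series_ne_zero (hμ : IsPositiveDensity μ f Φ) : Φ ≠ 0 := by
  rintro rfl
  have hf (x : ℝ) : f x = 0 := by
    rcases le_or_gt x 0 with hx | hx
    · exact hμ.eq_zero x hx
    · exact (hμ.hasMaclaurinSeries x hx).unique (by simp)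
  have hzero := hμ.eq_withDensity
  simp only [hf, ENNReal.ofReal_zero, withDensity_const, zero_smul] at hzero
  exact IsProbabilityMeasure.ne_zero μ hzero

end IsPositiveDensity

variable {Ω : Type*} [MeasurableSpace Ω] {P : Measure Ω}

theorem hasCdfSeries_map_sum {ι : Type*} {Y : ι → Ω → ℝ} {f : ι → ℝ → ℝ} {Φ : ι → ℝ⟦X⟧}
    (hmeas : ∀ i, AEMeasurable (Y i) P) (hindep : iIndepFun Y P)
    (hY : ∀ i, IsPositiveDensity (P.map (Y i)) (f i) (Φ i)) (s : Finset ι) :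
    HasCdfSeries (P.map (∑ i ∈ s, Y i)) (∏ i ∈ s, X * Φ i) := by
  classical
  have := hindep.isProbabilityMeasure
  induction s using Finset.induction_on with
  | empty =>
    have hdirac : P.map (0 : Ω → ℝ) = Measure.dirac 0 :=
      (Measure.map_const P (0 : ℝ)).trans (by rw [measure_univ, one_smul])
    rw [Finset.sum_empty, Finset.prod_empty, hdirac]
    exact hasCdfSeries_dirac_zero
  | insert j s hj ih =>
    have hsum : AEMeasurable (∑ i ∈ s, Y i) P := Finset.aemeasurable_sum s fun i _ => hmeas i
    have := Measure.isProbabilityMeasure_map hsum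
    have := Measure.isProbabilityMeasure_map (hmeas j)
    rw [Finset.sum_insert hj, add_comm,
      (hindep.indepFun_finsetSum_of_notMem₀ hmeas hj).map_add_eq_map_conv_map₀ hsum (hmeas j),
      Finset.prod_insert hj, mul_comm (X * _)]
    exact (hY j).hasCdfSeries_conv ih

theorem IsPositiveDensity.hasCdfSeries_map_sum_div {μ : Measure ℝ} {f : ℝ → ℝ} {Φ : ℝ⟦X⟧}
    (hμ : IsPositiveDensity μ f Φ) {ι : Type*} {Y : ι → Ω → ℝ} (hlaw : ∀ i, HasLaw (Y i) μ P)
    (hindep : iIndepFun Y P) {c : ι → ℝ} (hc : ∀ i, 0 < c i) (s : Finset ι) :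
    HasCdfSeries (P.map fun ω => ∑ i ∈ s, Y i ω / c i)
      (∏ i ∈ s, X * scaleDensity (c i) Φ) := by
  have hdensity (i : ι) : IsPositiveDensity (P.map fun ω => Y i ω / c i)
      (fun y => c i * f (c i * y)) (scaleDensity (c i) Φ) := by
    have hmap : P.map (fun ω => Y i ω / c i) = μ.map (· / c i) := by
      rw [← (hlaw i).map_eq, AEMeasurable.map_map_of_aemeasurable (by fun_prop)
        (hlaw i).aemeasurable]
      rfl
    exact hmap ▸ hμ.map_div (hc i)
  have hsum := hasCdfSeries_map_sum (fun i => (hlaw i).aemeasurable.div_const (c i))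
    (hindep.comp (fun i z => z / c i) fun i => measurable_id.div_const (c i)) hdensity s
  rwa [Finset.sum_fn] at hsum

theorem IsPositiveDensity.isRenyiSolution {μ : Measure ℝ}
    [IsProbabilityMeasure μ] {f : ℝ → ℝ} {Φ : ℝ⟦X⟧} (hμ : IsPositiveDensity μ f Φ) {n k : ℕ}
    (hk : 1 ≤ k) (hkn : k ≤ n) {Y : Fin n → Ω → ℝ} (hlaw : ∀ i, HasLaw (Y i) μ P)
    (hindep : iIndepFun Y P)
    (hrep : P.map (fun ω => ∑ j : Fin k, Y (Fin.castLE hkn j) ω / ((n : ℝ) - (j : ℕ))) =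
      P.map fun ω => orderStatistic (fun i => Y i ω) ⟨k - 1, Nat.sub_one_lt_of_le hk hkn⟩) :
    IsRenyiSolution n k Φ := by
  have hsum := (hμ.hasCdfSeries_map_sum_div (fun j => hlaw (Fin.castLE hkn j))
    (hindep.precomp (Fin.castLE_injective hkn)) (c := fun j : Fin k => (n : ℝ) - (j : ℕ))
    (fun j => sub_pos.2 (Nat.cast_lt.2 (j.2.trans_le hkn))) Finset.univ).hasMaclaurinSeries
  have horder := (hμ.hasCdfSeries.hasMaclaurinSeries.aeval (binomialTail ℝ n k)).congr
    (h := cdf (P.map fun ω => orderStatistic (fun i => Y i ω)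
      ⟨k - 1, Nat.sub_one_lt_of_le hk hkn⟩)) fun x _ => by
        rw [cdf_map_orderStatistic hlaw hindep, Nat.sub_add_cancel hk]
  have hseries := (hrep ▸ hsum).unique horder
  rwa [Fin.prod_univ_eq_prod_range
    (fun j => X * scaleDensity ((n : ℝ) - (j : ℕ)) Φ) k] at hseries

namespace IsPositiveDensity

variable {μ : Measure ℝ} {f : ℝ → ℝ} {a ρ : ℝ}

theorem eq_mul_exp (hμ : IsPositiveDensity μ f (geomSeries a ρ)) {x : ℝ} (hx : 0 < x) :
    f x = a * Real.exp (ρ * x) := by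
  refine (hμ.hasMaclaurinSeries x hx).unique ?_
  rw [Real.exp_eq_exp_ℝ]
  refine HasSum.congr_fun ((NormedSpace.expSeries_div_hasSum_exp (ρ * x)).mul_left a) fun q => ?_
  rw [coeff_borelTransform, coeff_geomSeries]
  ring

variable [IsProbabilityMeasure μ]

theorem geomSeries_coeff_pos (hμ : IsPositiveDensity μ f (geomSeries a ρ)) : 0 < a := by
  have hnonneg : 0 ≤ a * Real.exp (ρ * 1) := hμ.eq_mul_exp one_pos ▸ hμ.nonneg 1
  refine lt_of_le_of_ne (nonneg_of_mul_nonneg_left hnonneg (Real.exp_pos _)) ?_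
  rintro rfl
  exact hμ.series_ne_zero (by ext q; simp [coeff_geomSeries])

theorem geomSeries_ratio_neg (hμ : IsPositiveDensity μ f (geomSeries a ρ)) : ρ < 0 := by
  by_contra! hρ
  have ha := hμ.geomSeries_coeff_pos
  have hmass : (⊤ : ENNReal) ≤ μ Set.univ := by
    rw [hμ.eq_withDensity, withDensity_apply _ MeasurableSet.univ, Measure.restrict_univ]
    calc (⊤ : ENNReal) = ∫⁻ _ in Set.Ioi (0 : ℝ), ENNReal.ofReal a := by
          rw [setLIntegral_const, Real.volume_Ioi,
            ENNReal.mul_top (ENNReal.ofReal_pos.2 ha).ne']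
      _ ≤ ∫⁻ x in Set.Ioi (0 : ℝ), ENNReal.ofReal (f x) := by
          refine setLIntegral_mono hμ.measurable.ennreal_ofReal fun x hx => ?_
          rw [hμ.eq_mul_exp hx]
          exact ENNReal.ofReal_le_ofReal (le_mul_of_one_le_right ha.le
            (Real.one_le_exp (mul_nonneg hρ (le_of_lt hx))))
      _ ≤ ∫⁻ x, ENNReal.ofReal (f x) := setLIntegral_le_lintegral _ _
  rw [measure_univ] at hmass
  exact hmass.not_gt ENNReal.one_lt_top

theorem eq_smul_expMeasure (hμ : IsPositiveDensity μ f (geomSeries a ρ)) :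
    μ = ENNReal.ofReal (a / -ρ) • expMeasure (-ρ) := by
  have ha := hμ.geomSeries_coeff_pos
  have hρ := hμ.geomSeries_ratio_neg
  have hpdf : Measurable (gammaPDF 1 (-ρ)) := (measurable_gammaPDFReal 1 _).ennreal_ofReal
  rw [hμ.eq_withDensity, expMeasure, gammaMeasure, ← withDensity_smul _ hpdf]
  refine withDensity_congr_ae ?_
  filter_upwards [Measure.ae_ne volume (0 : ℝ)] with x hx
  change ENNReal.ofReal (f x) = ENNReal.ofReal (a / -ρ) * exponentialPDF (-ρ) x
  rcases lt_or_gt_of_ne hx with hx | hx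
  · rw [exponentialPDF_of_neg hx, hμ.eq_zero x hx.le, ENNReal.ofReal_zero, mul_zero]
  · have hratio : 0 ≤ a / -ρ := div_nonneg ha.le (neg_nonneg.2 hρ.le)
    rw [exponentialPDF_of_nonneg hx.le, hμ.eq_mul_exp hx, ← ENNReal.ofReal_mul hratio,
      ← mul_assoc, div_mul_cancel₀ _ (neg_ne_zero.2 hρ.ne), neg_mul, neg_neg]

theorem exists_eq_expMeasure (hμ : IsPositiveDensity μ f (geomSeries a ρ)) :
    ∃ r : ℝ, 0 < r ∧ μ = expMeasure r := by
  have hr : 0 < -ρ := neg_pos.2 hμ.geomSeries_ratio_neg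
  have := isProbabilityMeasure_expMeasure hr
  have hmass := congrArg (fun m : Measure ℝ => m Set.univ) hμ.eq_smul_expMeasure
  simp only [Measure.smul_apply, measure_univ, smul_eq_mul, mul_one] at hmass
  exact ⟨-ρ, hr, by rw [hμ.eq_smul_expMeasure, ← hmass, one_smul]⟩

end IsPositiveDensity

end Density

end FormalSeries

theorem theorem3 {Ω : Type*} [MeasurableSpace Ω] (P : Measure Ω) [IsProbabilityMeasure P]
    (μ : Measure ℝ) [IsProbabilityMeasure μ] (hμ : HasMaclaurinDensity μ)
    (n k : ℕ) (hn : 2 ≤ n) (hk : 1 ≤ k) (hkn : k ≤ n)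
    (X : Fin n → Ω → ℝ) (hlaw : ∀ i, HasLaw (X i) μ P) (hindep : iIndepFun X P)
    (hrep : IdentDistrib
      (fun ω => ∑ j : Fin k, X (Fin.castLE hkn j) ω / ((n : ℝ) - (j : ℕ)))
      (fun ω => orderStatistic (fun i => X i ω) ⟨k - 1, by omega⟩) P P) :
    ∃ r : ℝ, 0 < r ∧ μ = expMeasure r := by
  obtain ⟨f, Φ, hΦ⟩ := hμ.exists_isPositiveDensity
  have hsol : IsRenyiSolution n k Φ := hΦ.isRenyiSolution hk hkn hlaw hindep hrep.map_eq
  obtain ⟨a, ρ, rfl⟩ := hsol.exists_eq_geomSeries hn hk hkn hΦ.series_ne_zero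
  exact hΦ.exists_eq_expMeasure
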